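/- Let $r\ge 3$, let $p_1<p_2<\cdots<p_r$ be prime numbers, and let $n=p_1p_2\cdots p_r$. Let $C_n$ be the cyclic group of order $n$, and let $\mathcal{P}(C_n)$ be its power graph, that is, the simple undirected graph with vertex set $C_n$ in which two distinct elements are adjacent if and only if one of them is an integral power of the other. For a finite simple graph $\Gamma$ with non-empty vertex set, let the vertex connectivity $\kappa(\Gamma)$ be the minimum number of vertices whose removal leaves an induced subgraph that is disconnected or has only one vertex. Let $\phi$ be Euler's totient function and put $$\alpha(n)=\phi(n)+\frac{n}{p_1\cdots p_r}\left[p_1\cdots p_{r-1}-\phi(p_1\cdots p_{r-1})\right],$$ $$\gamma(n)=\phi(n)+\frac{n}{p_1\cdots p_r}\left[\phi(p_1\cdots p_{r-1})+\phi(p_1\cdots p_{r-2}p_r)+p_1\cdots p_{r-2}-\phi(p_1\cdots p_{r-2})\right]$$ (here $\frac{n}{p_1\cdots p_r}=1$, since $n=p_1\cdots p_r$). Then $$\kappa(\mathcal{P}(C_n))=\min\{\alpha(n),\gamma(n)\}.$$ -/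

import Mathlib

/-- The power graph of a group: the simple graph whose vertices are the group elements, two
distinct elements being adjacent iff one of them is an integral power of the other. -/
def powerGraph (G : Type*) [Group G] : SimpleGraph G where
  Adj x y := x ≠ y ∧ ((∃ k : ℤ, x = y ^ k) ∨ ∃ k : ℤ, y = x ^ k)
  symm := ⟨fun _ _ h => ⟨h.1.symm, h.2.symm⟩⟩
  loopless := ⟨fun _ h => h.1 rfl⟩

/-- The vertex connectivity of a simple graph on a finite nonempty vertex set: the minimum number
of vertices whose removal leaves an induced subgraph that is disconnected (has two vertices not
joined by a walk) or has exactly one vertex. For a finite nonempty vertex type the set of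
admissible cardinalities is nonempty (remove all vertices but one), so the infimum in `ℕ` is a
minimum. -/
noncomputable def vertexConnectivity {V : Type*} [Finite V] (Γ : SimpleGraph V) : ℕ :=
  sInf {k : ℕ | ∃ X : Set V, X.ncard = k ∧
    (¬ (Γ.induce Xᶜ).Preconnected ∨ Xᶜ.ncard = 1)}

/-- `α(n) = φ(n) + n/(p₁⋯pᵣ) · [p₁⋯pᵣ₋₁ − φ(p₁⋯pᵣ₋₁)]`, where `p₁, …, pᵣ` are the prime
divisors of `n`. The division is exact and the subtraction does not truncate, as `φ(m) ≤ m`. -/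
def alphaBound (r : ℕ) (p : ℕ → ℕ) (n : ℕ) : ℕ :=
  Nat.totient n + n / (∏ i ∈ Finset.Icc 1 r, p i) *
    ((∏ i ∈ Finset.Icc 1 (r - 1), p i) - Nat.totient (∏ i ∈ Finset.Icc 1 (r - 1), p i))

/-- `γ(n) = φ(n) + n/(p₁⋯pᵣ) · [φ(p₁⋯pᵣ₋₁) + φ(p₁⋯pᵣ₋₂pᵣ) + p₁⋯pᵣ₋₂ − φ(p₁⋯pᵣ₋₂)]`, where
`p₁, …, pᵣ` are the prime divisors of `n` and `r ≥ 2`. The division is exact and the subtraction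
does not truncate, as `φ(m) ≤ m`. -/
def gammaBound (r : ℕ) (p : ℕ → ℕ) (n : ℕ) : ℕ :=
  Nat.totient n + n / (∏ i ∈ Finset.Icc 1 r, p i) *
    (Nat.totient (∏ i ∈ Finset.Icc 1 (r - 1), p i) +
      Nat.totient ((∏ i ∈ Finset.Icc 1 (r - 2), p i) * p r) +
      ((∏ i ∈ Finset.Icc 1 (r - 2), p i) - Nat.totient (∏ i ∈ Finset.Icc 1 (r - 2), p i)))

/-! In a cyclic group, x is a power of y exactly when the order of x divides that of y. So the power
graph is the comparability graph of the divisors of n under divisibility, with each d blown up to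
φ(d) vertices. A cut amounts to a set of divisors, weighted by φ, whose complement splits into two
nonempty, mutually incomparable sets A and B. Write n = mpq with p < q the two largest primes.
Isolating the order mp costs α, and isolating the order m costs γ.

For the lower bound, sort the primes k of n by whether n/k lies in A, in B or in the cut. Let a, b,
c be the products of the three classes, so n = abc, and let K be the third class. An element of A
not divisible by some j with n/j in B would divide n/j. Hence b divides all of A and, likewise, a
divides all of B. So the cut contains n, the n/k with k in K, and every divisor that is a multiple
of neither a nor b. The last kind weighs at least (a - φ(a))(b - φ(b))c
(`totient_add_sum_add_mul_le`).

If a, b ≠ 1, then |K| ≤ 1 yields α (`sub_totient_le_mul`, `sub_totient_le_add_mul`) and |K| = 2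
yields γ. If |K| ≥ 3, the terms φ(n/k) alone reach γ, because p_i ≥ i + 1 forces φ(n) ≥ n/q. If a =
1, the least element of A misses at least two primes, all of them in K, and again γ results; b = 1
is symmetric. -/

/-! ### Totient inequalities -/

open Nat in
theorem sum_totient_properDivisors {n : ℕ} (hn : 0 < n) :
    ∑ d ∈ n.properDivisors, φ d = n - φ n := by
  have h := Nat.sum_divisors_eq_sum_properDivisors_add_self (n := n)
  have h1 := Nat.sum_totient n
  rw [← Nat.insert_self_properDivisors hn.ne', Finset.sum_insert Nat.self_notMem_properDivisors]
    at h1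
  omega

theorem gcd_mul_mul_eq_left {a b c x y z : ℕ} (hab : a.Coprime b) (hac : a.Coprime c)
    (hx : x ∣ a) (hy : y ∣ b) (hz : z ∣ c) : a.gcd (x * y * z) = x := by
  rw [Nat.Coprime.gcd_mul_right_cancel_right _ (hac.coprime_dvd_right hz).symm,
    Nat.Coprime.gcd_mul_right_cancel_right _ (hab.coprime_dvd_right hy).symm,
    Nat.gcd_eq_right hx]

open Nat in
/-- A lower bound for the totient sum over the divisors of `a * b * c` that are divisible neither
by `a` nor by `b`. -/
theorem le_sum_totient_not_dvd {a b c : ℕ} (ha : 0 < a) (hb : 0 < b) (hc : 0 < c)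
    (hab : a.Coprime b) (hac : a.Coprime c) (hbc : b.Coprime c) :
    (a - φ a) * (b - φ b) * c ≤ ∑ d ∈ (a * b * c).divisors with ¬ a ∣ d ∧ ¬ b ∣ d, φ d := by
  -- The factors of xyz are recovered as its gcds with a, b and c. This makes the product map
  -- injective, and properness of x and y keeps a and b from dividing xyz.
  have key : ∀ t ∈ (a.properDivisors ×ˢ b.properDivisors) ×ˢ c.divisors,
      a.gcd (t.1.1 * t.1.2 * t.2) = t.1.1 ∧ b.gcd (t.1.1 * t.1.2 * t.2) = t.1.2 ∧
        c.gcd (t.1.1 * t.1.2 * t.2) = t.2 := by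
    rintro ⟨⟨x, y⟩, z⟩ h
    simp only [Finset.mem_product, Nat.mem_properDivisors, Nat.mem_divisors] at h ⊢
    refine ⟨gcd_mul_mul_eq_left hab hac h.1.1.1 h.1.2.1 h.2.1, ?_, ?_⟩
    · rw [mul_comm x y]
      exact gcd_mul_mul_eq_left hab.symm hbc h.1.2.1 h.1.1.1 h.2.1
    · rw [mul_comm, ← mul_assoc]
      exact gcd_mul_mul_eq_left hac.symm hbc.symm h.2.1 h.1.1.1 h.1.2.1
  have hinj : Set.InjOn (fun t : (ℕ × ℕ) × ℕ => t.1.1 * t.1.2 * t.2)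
      ((a.properDivisors ×ˢ b.properDivisors) ×ˢ c.divisors : Finset ((ℕ × ℕ) × ℕ)) := by
    intro s hs t ht hst
    have h1 := key s hs
    have h2 := key t ht
    simp only at hst
    rw [hst] at h1
    exact Prod.ext (Prod.ext (h1.1.symm.trans h2.1) (h1.2.1.symm.trans h2.2.1))
      (h1.2.2.symm.trans h2.2.2)
  calc (a - φ a) * (b - φ b) * c
      = ∑ t ∈ (a.properDivisors ×ˢ b.properDivisors) ×ˢ c.divisors,
          φ t.1.1 * φ t.1.2 * φ t.2 := by
        rw [← sum_totient_properDivisors ha, ← sum_totient_properDivisors hb,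
          Finset.sum_product, Finset.sum_product, Finset.sum_mul_sum, Finset.sum_mul]
        refine Finset.sum_congr rfl fun x _ => ?_
        rw [Finset.sum_mul]
        refine Finset.sum_congr rfl fun y _ => ?_
        simp only []
        rw [← Finset.mul_sum, Nat.sum_totient]
    _ = ∑ t ∈ (a.properDivisors ×ˢ b.properDivisors) ×ˢ c.divisors,
          φ (t.1.1 * t.1.2 * t.2) := by
        refine Finset.sum_congr rfl fun t ht => ?_
        simp only [Finset.mem_product, Nat.mem_properDivisors, Nat.mem_divisors] at ht
        obtain ⟨⟨⟨hx, -⟩, hy, -⟩, hz, -⟩ := ht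
        rw [Nat.totient_mul, Nat.totient_mul]
        · exact (hab.coprime_dvd_left hx).coprime_dvd_right hy
        · exact Nat.Coprime.mul_left ((hac.coprime_dvd_left hx).coprime_dvd_right hz)
            ((hbc.coprime_dvd_left hy).coprime_dvd_right hz)
    _ = ∑ d ∈ ((a.properDivisors ×ˢ b.properDivisors) ×ˢ c.divisors).image
          (fun t => t.1.1 * t.1.2 * t.2), φ d := (Finset.sum_image hinj).symm
    _ ≤ _ := by
        refine Finset.sum_le_sum_of_subset fun d hd => ?_
        obtain ⟨t, ht, rfl⟩ := Finset.mem_image.1 hd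
        obtain ⟨h1, h2, -⟩ := key t ht
        simp only [Finset.mem_product, Nat.mem_properDivisors, Nat.mem_divisors] at ht
        rw [Finset.mem_filter, Nat.mem_divisors]
        refine ⟨⟨mul_dvd_mul (mul_dvd_mul ht.1.1.1 ht.1.2.1) ht.2.1, by positivity⟩, ?_, ?_⟩
        · intro h
          rw [Nat.gcd_eq_left h] at h1
          omega
        · intro h
          rw [Nat.gcd_eq_left h] at h2
          omega

open Nat in
theorem Squarefree.totient_div_mul {n k : ℕ} (hn : Squarefree n) (hk : k.Prime) (hkn : k ∣ n) :
    φ (n / k) * (k - 1) = φ n := by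
  obtain ⟨l, rfl⟩ := hkn
  rw [Nat.mul_div_cancel_left _ hk.pos, Nat.totient_mul (Nat.coprime_of_squarefree_mul hn),
    Nat.totient_prime hk, mul_comm]

open Nat in
theorem Squarefree.mul_totient_le {n k : ℕ} (hn : Squarefree n) (hk : k.Prime) (hkn : k ∣ n) :
    k * φ n ≤ (k - 1) * n := by
  obtain ⟨l, rfl⟩ := hkn
  rw [Nat.totient_mul (Nat.coprime_of_squarefree_mul hn), Nat.totient_prime hk]
  nlinarith [Nat.mul_le_mul_left (k * (k - 1)) (Nat.totient_le l)]

-- Multiples of k are nonunits modulo n, so nonunits make up at least the fraction 1/k of all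
-- residues.
open Nat in
theorem Squarefree.le_sub_totient_mul {n k : ℕ} (hn : Squarefree n) (hk : k.Prime) (hkn : k ∣ n) :
    n ≤ (n - φ n) * k := by
  have h := hn.mul_totient_le hk hkn
  have h1 := Nat.totient_le n
  zify [hk.one_le] at h
  zify [h1]
  nlinarith

open Nat in
theorem Squarefree.totient_div_le_totient_div {n k l : ℕ} (hn : Squarefree n) (hk : k.Prime)
    (hl : l.Prime) (hkn : k ∣ n) (hln : l ∣ n) (hkl : k ≤ l) : φ (n / l) ≤ φ (n / k) := by
  have h1 := hn.totient_div_mul hk hkn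
  have h2 := hn.totient_div_mul hl hln
  have h3 : 0 < k - 1 := by have := hk.two_le; omega
  refine Nat.le_of_mul_le_mul_right ?_ h3
  rw [h1, ← h2]
  exact Nat.mul_le_mul_left _ (by omega)

open Nat in
/-- The number of nonunits modulo `n / k` decreases with the prime divisor `k` of `n`. -/
theorem Squarefree.sub_totient_div_le {n k l : ℕ} (hn : Squarefree n) (hk : k.Prime)
    (hl : l.Prime) (hkn : k ∣ n) (hln : l ∣ n) (hkl : k ≤ l) :
    n / l - φ (n / l) ≤ n / k - φ (n / k) := by
  rcases hkl.eq_or_lt with rfl | hlt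
  · rfl
  obtain ⟨u, rfl⟩ := ((Nat.coprime_primes hk hl).2 hlt.ne).mul_dvd_of_dvd_of_dvd hkn hln
  have e1 : k * l * u / l = k * u := by
    rw [mul_right_comm, Nat.mul_div_cancel _ hl.pos]
  have e2 : k * l * u / k = l * u := by
    rw [mul_assoc, Nat.mul_div_cancel_left _ hk.pos]
  rw [mul_assoc] at hn
  have hlu := hn.of_mul_right
  rw [mul_left_comm] at hn
  have hku := hn.of_mul_right
  rw [e1, e2, Nat.totient_mul (Nat.coprime_of_squarefree_mul hku),
    Nat.totient_mul (Nat.coprime_of_squarefree_mul hlu), Nat.totient_prime hk,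
    Nat.totient_prime hl]
  have h1 := Nat.totient_le u
  have h2 : (k - 1) * φ u ≤ k * u := Nat.mul_le_mul (by omega) h1
  have h3 : (l - 1) * φ u ≤ l * u := Nat.mul_le_mul (by omega) h1
  have h4 : (φ u : ℤ) ≤ u := by exact_mod_cast h1
  have h5 : (k : ℤ) ≤ l := by exact_mod_cast hkl
  zify [h1, h2, h3, hk.one_le, hl.one_le]
  -- Both sides have the form t(u - φ(u)) + φ(u), with t = k and t = l.
  nlinarith

theorem Finset.exists_lt_lt_of_two_lt_card {K : Finset ℕ} (h : 2 < K.card) :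
    ∃ i ∈ K, ∃ j ∈ K, ∃ k ∈ K, i < j ∧ j < k := by
  obtain ⟨a, b, c, ha, hb, hc, hab, hac, hbc⟩ := Finset.two_lt_card.1 h
  grind

open Nat in
/-- The totient weight of the divisors missing a prime of each of two complementary divisors is
least when one of them is the largest prime. -/
theorem sub_totient_le_mul_of_dvd {a b q s : ℕ} (hsq : Squarefree (a * b)) (hq : q.Prime)
    (hqa : q ∣ a) (hs : s * q = a * b) (hlt : ∀ k, k.Prime → k ∣ b → k < q) (hb : b ≠ 1) :
    s - φ s ≤ (a - φ a) * (b - φ b) := by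
  obtain ⟨u, rfl⟩ := hqa
  have hs' : s = u * b := Nat.eq_of_mul_eq_mul_right hq.pos (by rw [hs]; ring)
  subst hs'
  have hub : u.Coprime b :=
    (Nat.coprime_of_squarefree_mul hsq).coprime_dvd_left (dvd_mul_left _ _)
  rw [Nat.totient_mul hub, Nat.totient_mul (Nat.coprime_of_squarefree_mul hsq.of_mul_left),
    Nat.totient_prime hq]
  obtain ⟨j, hj, hjb⟩ := Nat.exists_prime_and_dvd hb
  have h0 : b ≤ (b - φ b) * q := (hsq.of_mul_right.le_sub_totient_mul hj hjb).trans
    (Nat.mul_le_mul_left _ (hlt j hj hjb).le)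
  have h1 := Nat.totient_le u
  have h2 := Nat.totient_le b
  have h3 : (q - 1) * φ u ≤ q * u := Nat.mul_le_mul (by omega) h1
  have h4 : φ u * φ b ≤ u * b := Nat.mul_le_mul h1 h2
  have h5 : (φ u : ℤ) ≤ u := by exact_mod_cast h1
  zify [h2] at h0
  zify [h1, h2, h3, h4, hq.one_le]
  -- With a = qu and s = ub, right side minus left side equals (u - φ(u))(q(b - φ(b)) - b).
  nlinarith [mul_le_mul_of_nonneg_left h0 (sub_nonneg.2 h5)]

-- Settles the case c = 1: the largest prime q divides a or b, and the two cases are symmetric.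
open Nat in
theorem sub_totient_le_mul {a b q s : ℕ} (hsq : Squarefree (a * b)) (hq : q.Prime)
    (hs : s * q = a * b) (hlt : ∀ k, k.Prime → k ∣ a * b → k ≤ q) (ha : a ≠ 1) (hb : b ≠ 1) :
    s - φ s ≤ (a - φ a) * (b - φ b) := by
  have hab := Nat.coprime_of_squarefree_mul hsq
  have hqab : q ∣ a * b := hs ▸ dvd_mul_left _ _
  rcases (Nat.Prime.dvd_mul hq).1 hqab with h | h
  · refine sub_totient_le_mul_of_dvd hsq hq h hs (fun k hk hkb => ?_) hb
    refine (hlt k hk (hkb.mul_left a)).lt_of_ne ?_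
    rintro rfl
    exact hk.one_lt.ne' (Nat.eq_one_of_dvd_coprimes hab h hkb)
  · rw [mul_comm]
    rw [mul_comm a b] at hsq hs hlt
    refine sub_totient_le_mul_of_dvd hsq hq h hs (fun k hk hkb => ?_) ha
    refine (hlt k hk (hkb.mul_left b)).lt_of_ne ?_
    rintro rfl
    exact hk.one_lt.ne' (Nat.eq_one_of_dvd_coprimes hab hkb h)

open Nat in
/-- Absorbing the prime `k` into `a` does not increase the weight when `b` has many units. -/
theorem mul_sub_totient_le_of_le_two_mul {a b k : ℕ} (hk : k.Prime) (hka : k.Coprime a)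
    (hb : b ≤ 2 * φ b) :
    (k * a - φ (k * a)) * (b - φ b) ≤ φ a * φ b + (a - φ a) * (b - φ b) * k := by
  rw [Nat.totient_mul hka, Nat.totient_prime hk]
  have h1 := Nat.totient_le a
  have h2 := Nat.totient_le b
  have h3 : (k - 1) * φ a ≤ k * a := Nat.mul_le_mul (by omega) h1
  zify at hb
  zify [h1, h2, h3, hk.one_le]
  -- Here ka - φ(ka) = k(a - φ(a)) + φ(a), and `hb` says b - φ(b) ≤ φ(b).
  nlinarith [mul_le_mul_of_nonneg_left hb (Int.natCast_nonneg (φ a))]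

-- Settles the case where c is a prime k. If a or b has at least as many units as nonunits, k is
-- absorbed into the other factor, which reduces to c = 1.
open Nat in
theorem sub_totient_le_add_mul {a b k q s : ℕ} (hsq : Squarefree (a * b * k)) (hk : k.Prime)
    (hq : q.Prime) (hq4 : 4 ≤ q) (hs : s * q = a * b * k)
    (hlt : ∀ l, l.Prime → l ∣ a * b * k → l ≤ q) (ha : a ≠ 1) (hb : b ≠ 1) :
    s - φ s ≤ φ (a * b) + (a - φ a) * (b - φ b) * k := by
  have hab := Nat.coprime_of_squarefree_mul hsq.of_mul_left
  have hk1 := Nat.coprime_of_squarefree_mul hsq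
  have hka : k.Coprime a := (hk1.coprime_dvd_left (dvd_mul_right _ _)).symm
  have hkb : k.Coprime b := (hk1.coprime_dvd_left (dvd_mul_left _ _)).symm
  have hk2 : ∀ x, k * x ≠ 1 := fun x h => hk.one_lt.ne' (Nat.eq_one_of_mul_eq_one_right h)
  rw [Nat.totient_mul hab]
  by_cases h1 : b ≤ 2 * φ b
  · refine le_trans ?_ (mul_sub_totient_le_of_le_two_mul hk hka h1)
    have e : a * b * k = k * a * b := by ring
    rw [e] at hsq hs hlt
    exact sub_totient_le_mul hsq hq hs hlt (hk2 a) hb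
  by_cases h2 : a ≤ 2 * φ a
  · have h := mul_sub_totient_le_of_le_two_mul hk hkb h2
    rw [mul_comm (φ b), mul_comm (b - φ b)] at h
    refine le_trans ?_ h
    have e : a * b * k = k * b * a := by ring
    rw [e] at hsq hs hlt
    exact sub_totient_le_mul hsq hq hs hlt (hk2 b) ha
  -- Nonunits are now the majority modulo a and modulo b, so the product term is at least abk/4,
  -- while s = abk/q ≤ abk/4.
  · have h3 : a * b ≤ 4 * ((a - φ a) * (b - φ b)) := by
      have : a * b ≤ (2 * (a - φ a)) * (2 * (b - φ b)) := Nat.mul_le_mul (by omega) (by omega)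
      linarith
    have h4 : 4 * s ≤ 4 * ((a - φ a) * (b - φ b) * k) := by
      nlinarith [Nat.mul_le_mul_right k h3, Nat.mul_le_mul_left s hq4]
    omega

/-! ### Incomparable sets of divisors and the weight of the cut between them -/

/-- The primes `k` dividing `n` for which the maximal proper divisor `n / k` lies in `A`. -/
def cofactorPrimes (n : ℕ) (A : Finset ℕ) : Finset ℕ :=
  n.primeFactors.filter fun k => n / k ∈ A

theorem mem_cofactorPrimes {n k : ℕ} {A : Finset ℕ} (hn : n ≠ 0) :
    k ∈ cofactorPrimes n A ↔ (k.Prime ∧ k ∣ n) ∧ n / k ∈ A := by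
  simp [cofactorPrimes, hn]

theorem Nat.dvd_div_of_prime_of_not_dvd {n d k : ℕ} (hk : k.Prime) (hkn : k ∣ n) (hd : d ∣ n)
    (h : ¬ k ∣ d) : d ∣ n / k := by
  obtain ⟨l, rfl⟩ := hkn
  rw [Nat.mul_div_cancel_left _ hk.pos]
  exact ((Nat.Prime.coprime_iff_not_dvd hk).2 h).symm.dvd_of_dvd_mul_left hd

theorem Squarefree.exists_prime_of_not_dvd {n d : ℕ} (hn : Squarefree n) (h : ¬ n ∣ d) :
    ∃ k, k.Prime ∧ k ∣ n ∧ ¬ k ∣ d := by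
  by_contra! hk
  refine h ?_
  rw [← Nat.prod_primeFactors_of_squarefree hn]
  exact Finset.prod_primes_dvd d (fun k hk => (Nat.prime_of_mem_primeFactors hk).prime)
    fun k hkn => hk k (Nat.prime_of_mem_primeFactors hkn) (Nat.dvd_of_mem_primeFactors hkn)

theorem Squarefree.not_dvd_div {n k : ℕ} (hn : Squarefree n) (hk : k.Prime) (hkn : k ∣ n) :
    ¬ k ∣ n / k := by
  obtain ⟨l, rfl⟩ := hkn
  rw [Nat.mul_div_cancel_left _ hk.pos]
  exact (Nat.Prime.coprime_iff_not_dvd hk).1 (Nat.coprime_of_squarefree_mul hn)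

/-- No element of `A` is comparable, with respect to divisibility, with an element of `B`. -/
def DvdIncomparable (A B : Finset ℕ) : Prop :=
  ∀ a ∈ A, ∀ b ∈ B, ¬ a ∣ b ∧ ¬ b ∣ a

theorem DvdIncomparable.symm {A B : Finset ℕ} (h : DvdIncomparable A B) : DvdIncomparable B A :=
  fun b hb a ha => (h a ha b hb).symm

theorem DvdIncomparable.self_notMem_left {n : ℕ} {A B : Finset ℕ} (h : DvdIncomparable A B)
    (hB : B ⊆ n.divisors) (hB0 : B.Nonempty) : n ∉ A := by
  obtain ⟨b, hb⟩ := hB0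
  exact fun hn => (h n hn b hb).2 (Nat.dvd_of_mem_divisors (hB hb))

/-- If a prime j with n/j in B did not divide d, then d would divide n/j, against incomparability.
-/
theorem prod_cofactorPrimes_dvd_of_mem {n d : ℕ} {A B : Finset ℕ} (hn : n ≠ 0)
    (h : DvdIncomparable A B) (hA : A ⊆ n.divisors) (hd : d ∈ A) :
    ∏ j ∈ cofactorPrimes n B, j ∣ d := by
  refine Finset.prod_primes_dvd d (fun j hj => ((mem_cofactorPrimes hn).1 hj).1.1.prime)
    fun j hj => ?_
  obtain ⟨⟨hjp, hjn⟩, hjB⟩ := (mem_cofactorPrimes hn).1 hj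
  by_contra hjd
  exact (h d hd _ hjB).1
    (Nat.dvd_div_of_prime_of_not_dvd hjp hjn (Nat.dvd_of_mem_divisors (hA hd)) hjd)

theorem prod_cofactorPrimes_mul {n : ℕ} {A B : Finset ℕ} (hn : Squarefree n)
    (h : DvdIncomparable A B) :
    (∏ i ∈ cofactorPrimes n A, i) * (∏ i ∈ cofactorPrimes n B, i) *
      ∏ i ∈ cofactorPrimes n (n.divisors \ (A ∪ B)), i = n := by
  have hd1 : Disjoint (cofactorPrimes n A) (cofactorPrimes n B) := by
    rw [Finset.disjoint_left]
    intro i hi hj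
    rw [mem_cofactorPrimes hn.ne_zero] at hi hj
    exact (h _ hi.2 _ hj.2).1 dvd_rfl
  have hd2 : Disjoint (cofactorPrimes n A ∪ cofactorPrimes n B)
      (cofactorPrimes n (n.divisors \ (A ∪ B))) := by
    rw [Finset.disjoint_left]
    intro i hi hj
    rw [Finset.mem_union] at hi
    simp only [mem_cofactorPrimes hn.ne_zero, Finset.mem_sdiff, Finset.mem_union] at hi hj
    tauto
  rw [← Finset.prod_union hd1, ← Finset.prod_union hd2]
  conv_rhs => rw [← Nat.prod_primeFactors_of_squarefree hn]
  refine Finset.prod_congr ?_ fun _ _ => rfl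
  ext i
  simp only [Finset.mem_union, mem_cofactorPrimes hn.ne_zero, Finset.mem_sdiff,
    Nat.mem_primeFactors, Nat.mem_divisors]
  have : i ∣ n → n / i ∣ n := Nat.div_dvd_of_dvd
  have := hn.ne_zero
  tauto

-- The three terms weigh disjoint pieces of the cut. Combined with `hE`, the hypothesis `hkE` says
-- that E contains no n/k.
open Nat in
theorem totient_add_sum_le {n : ℕ} {A B : Finset ℕ} (hn : Squarefree n)
    (hA : A ⊆ n.divisors) (hB : B ⊆ n.divisors) (hA0 : A.Nonempty) (hB0 : B.Nonempty)
    (h : DvdIncomparable A B) {E : Finset ℕ} (hE : E ⊆ n.divisors \ (A ∪ B))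
    (hnE : n ∉ E) (hkE : ∀ k, k.Prime → k ∣ n → n / k ∈ E → n / k ∈ A ∪ B) :
    φ n + ∑ k ∈ cofactorPrimes n (n.divisors \ (A ∪ B)), φ (n / k) + ∑ d ∈ E, φ d
      ≤ ∑ d ∈ n.divisors \ (A ∪ B), φ d := by
  have hinj : Set.InjOn (fun k => n / k) (cofactorPrimes n (n.divisors \ (A ∪ B)) : Set ℕ) := by
    intro k hk l hl hkl
    rw [Finset.mem_coe, mem_cofactorPrimes hn.ne_zero] at hk hl
    have h1 := Nat.div_mul_cancel hk.1.2
    have h2 := Nat.div_mul_cancel hl.1.2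
    simp only at hkl
    rw [hkl] at h1
    refine Nat.eq_of_mul_eq_mul_left (Nat.pos_of_ne_zero fun h0 => ?_) (h1.trans h2.symm)
    rw [h0, zero_mul] at h2
    exact hn.ne_zero h2.symm
  rw [← Finset.sum_image (f := fun d => φ d) hinj, ← Finset.sum_insert (f := fun d => φ d),
    ← Finset.sum_union]
  · refine Finset.sum_le_sum_of_subset ?_
    refine Finset.union_subset (Finset.insert_subset ?_ ?_) hE
    · rw [Finset.mem_sdiff, Finset.mem_union]
      exact ⟨Nat.mem_divisors_self n hn.ne_zero, fun h' => h'.elim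
        (h.self_notMem_left hB hB0) (h.symm.self_notMem_left hA hA0)⟩
    · intro d hd
      obtain ⟨k, hk, rfl⟩ := Finset.mem_image.1 hd
      exact ((mem_cofactorPrimes hn.ne_zero).1 hk).2
  · rw [Finset.disjoint_left]
    intro d hd hdE
    rcases Finset.mem_insert.1 hd with rfl | hd
    · exact hnE hdE
    · obtain ⟨k, hk, rfl⟩ := Finset.mem_image.1 hd
      rw [mem_cofactorPrimes hn.ne_zero] at hk
      exact (Finset.mem_sdiff.1 hk.2).2 (hkE k hk.1.1 hk.1.2 hdE)
  · intro hd
    obtain ⟨k, hk, hkn⟩ := Finset.mem_image.1 hd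
    rw [mem_cofactorPrimes hn.ne_zero] at hk
    exact (Nat.div_lt_self (Nat.pos_of_ne_zero hn.ne_zero) hk.1.1.one_lt).ne hkn

-- Takes for E the divisors that are multiples of neither a nor b. They avoid A and B, whose
-- elements are multiples of b and of a respectively. For k in the third class, n/k is a multiple of
-- a, hence not in E.
open Nat in
theorem totient_add_sum_add_mul_le {n : ℕ} {A B : Finset ℕ} (hn : Squarefree n)
    (hA : A ⊆ n.divisors) (hB : B ⊆ n.divisors) (hA0 : A.Nonempty) (hB0 : B.Nonempty)
    (h : DvdIncomparable A B) {a b c : ℕ} (ha : a = ∏ i ∈ cofactorPrimes n A, i)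
    (hb : b = ∏ i ∈ cofactorPrimes n B, i)
    (hc : c = ∏ i ∈ cofactorPrimes n (n.divisors \ (A ∪ B)), i) :
    φ n + ∑ k ∈ cofactorPrimes n (n.divisors \ (A ∪ B)), φ (n / k) + (a - φ a) * (b - φ b) * c
      ≤ ∑ d ∈ n.divisors \ (A ∪ B), φ d := by
  have habc : a * b * c = n := by
    rw [ha, hb, hc]
    exact prod_cofactorPrimes_mul hn h
  have hn' := hn
  rw [← habc] at hn'
  have hab := Nat.coprime_of_squarefree_mul hn'.of_mul_left
  have hc' := Nat.coprime_of_squarefree_mul hn'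
  have hpos : ∀ {x}, x ∣ n → 0 < x := fun hx => Nat.pos_of_dvd_of_pos hx
    (Nat.pos_of_ne_zero hn.ne_zero)
  have han : a ∣ n := by rw [← habc, mul_assoc]; exact dvd_mul_right _ _
  have hbn : b ∣ n := by rw [← habc, mul_right_comm]; exact dvd_mul_left _ _
  have hcn : c ∣ n := by rw [← habc]; exact dvd_mul_left _ _
  have key := le_sum_totient_not_dvd (hpos han) (hpos hbn) (hpos hcn) hab
    (hc'.coprime_dvd_left (dvd_mul_right _ _)) (hc'.coprime_dvd_left (dvd_mul_left _ _))
  rw [habc] at key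
  refine (Nat.add_le_add_left key _).trans
    (totient_add_sum_le hn hA hB hA0 hB0 h (fun d hd => ?_) ?_ ?_)
  · rw [Finset.mem_filter] at hd
    rw [Finset.mem_sdiff, Finset.mem_union]
    refine ⟨hd.1, ?_⟩
    rintro (hdA | hdB)
    · exact hd.2.2 (hb ▸ prod_cofactorPrimes_dvd_of_mem hn.ne_zero h hA hdA)
    · exact hd.2.1 (ha ▸ prod_cofactorPrimes_dvd_of_mem hn.ne_zero h.symm hB hdB)
  · intro hmem
    exact (Finset.mem_filter.1 hmem).2.1 han
  · intro k hk hkn hmem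
    by_contra hnot
    have hkK : k ∣ c := by
      rw [hc]
      refine Finset.dvd_prod_of_mem _ ((mem_cofactorPrimes hn.ne_zero).2 ⟨⟨hk, hkn⟩, ?_⟩)
      exact Finset.mem_sdiff.2 ⟨(Finset.mem_filter.1 hmem).1, hnot⟩
    refine (Finset.mem_filter.1 hmem).2.1 ?_
    rw [← habc, Nat.mul_div_assoc _ hkK, mul_assoc]
    exact dvd_mul_right _ _

/-! ### The lower bound for the weight of a cut -/

/-- `q` and `p` are the largest and the second largest prime divisor of the squarefree number
`m * p * q`, which has not too many small prime divisors. -/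
structure LargestPrimes (m p q : ℕ) : Prop where
  squarefree : Squarefree (m * p * q)
  prime_left : p.Prime
  prime_right : q.Prime
  lt : p < q
  lt_of_dvd : ∀ k, k.Prime → k ∣ m → k < p
  le_totient_mul : m * p * q ≤ Nat.totient (m * p * q) * q

namespace LargestPrimes

open Nat

variable {m p q : ℕ}

theorem pos (h : LargestPrimes m p q) : 0 < m := by
  refine Nat.pos_of_ne_zero ?_
  rintro rfl
  simpa using h.squarefree.ne_zero

theorem le_right (h : LargestPrimes m p q) {k : ℕ} (hk : k.Prime) (hkn : k ∣ m * p * q) :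
    k ≤ q := by
  have := h.lt
  rcases hk.dvd_mul.1 hkn with hkn | hkn
  · rcases hk.dvd_mul.1 hkn with hkn | hkn
    · have := h.lt_of_dvd k hk hkn
      omega
    · rw [(Nat.prime_dvd_prime_iff_eq hk h.prime_left).1 hkn]
      omega
  · exact Nat.le_of_dvd h.prime_right.pos hkn

theorem le_left (h : LargestPrimes m p q) {k : ℕ} (hk : k.Prime) (hkn : k ∣ m * p * q)
    (hkq : k ≠ q) : k ≤ p := by
  rcases hk.dvd_mul.1 hkn with hkn | hkn
  · rcases hk.dvd_mul.1 hkn with hkn | hkn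
    · exact (h.lt_of_dvd k hk hkn).le
    · exact Nat.le_of_dvd h.prime_left.pos hkn
  · exact absurd ((Nat.prime_dvd_prime_iff_eq hk h.prime_right).1 hkn) hkq

theorem left_dvd : p ∣ m * p * q := (dvd_mul_left _ _).mul_right _

theorem right_dvd : q ∣ m * p * q := dvd_mul_left _ _

theorem div_right (h : LargestPrimes m p q) : m * p * q / q = m * p :=
  Nat.mul_div_cancel _ h.prime_right.pos

theorem div_left (h : LargestPrimes m p q) : m * p * q / p = m * q := by
  rw [mul_right_comm, Nat.mul_div_cancel _ h.prime_left.pos]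

/-- Since φ(n/k) = φ(n)/(k - 1) decreases with k, the two largest primes minimise the sum. -/
theorem totient_add_totient_le (h : LargestPrimes m p q) {k l : ℕ} (hk : k.Prime) (hl : l.Prime)
    (hkn : k ∣ m * p * q) (hln : l ∣ m * p * q) (hkl : k ≠ l) :
    φ (m * p) + φ (m * q) ≤ φ (m * p * q / k) + φ (m * p * q / l) := by
  wlog hlt : k < l generalizing k l
  · rw [add_comm (φ (m * p * q / k))]
    exact this hl hk hln hkn hkl.symm (by omega)
  have hlq := h.le_right hl hln
  have h1 := h.squarefree.totient_div_le_totient_div hl h.prime_right hln right_dvd hlq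
  have h2 := h.squarefree.totient_div_le_totient_div hk h.prime_left hkn left_dvd
    (h.le_left hk hkn (hlt.trans_le hlq).ne)
  rw [h.div_right] at h1
  rw [h.div_left] at h2
  omega

/-- φ(n/k) = φ(n)/(k - 1) ≥ φ(n)/p ≥ n/(pq) = m, by `le_totient_mul`. -/
theorem le_totient_div (h : LargestPrimes m p q) {k : ℕ} (hk : k.Prime) (hkn : k ∣ m * p * q)
    (hkp : k ≤ p) : m ≤ φ (m * p * q / k) := by
  have h1 := h.squarefree.totient_div_mul hk hkn
  have h2 : φ (m * p * q) ≤ φ (m * p * q / k) * p := by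
    rw [← h1]
    exact Nat.mul_le_mul_left _ (by omega)
  have h3 : m * (p * q) ≤ φ (m * p * q / k) * (p * q) := by
    rw [← mul_assoc, ← mul_assoc]
    exact h.le_totient_mul.trans (Nat.mul_le_mul_right q h2)
  exact Nat.le_of_mul_le_mul_right h3 (Nat.mul_pos h.prime_left.pos h.prime_right.pos)

/-- Of three primes in K, the larger two pay for φ(mp) + φ(mq). The smallest is at most p, so it
contributes at least m. -/
theorem le_sum_of_two_lt_card (h : LargestPrimes m p q) {K : Finset ℕ} (hK : 2 < K.card)
    (hKn : ∀ k ∈ K, k.Prime ∧ k ∣ m * p * q) :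
    φ (m * p) + φ (m * q) + (m - φ m) ≤ ∑ k ∈ K, φ (m * p * q / k) := by
  obtain ⟨i, hi, j, hj, k, hk, hij, hjk⟩ := Finset.exists_lt_lt_of_two_lt_card hK
  have h1 := h.totient_add_totient_le (hKn j hj).1 (hKn k hk).1 (hKn j hj).2 (hKn k hk).2 hjk.ne
  have hiq := h.le_right (hKn k hk).1 (hKn k hk).2
  have h2 := h.le_totient_div (hKn i hi).1 (hKn i hi).2
    (h.le_left (hKn i hi).1 (hKn i hi).2 (by omega))
  have h3 : ∑ x ∈ ({i, j, k} : Finset ℕ), φ (m * p * q / x) ≤ ∑ x ∈ K, φ (m * p * q / x) :=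
    Finset.sum_le_sum_of_subset (by simp [Finset.insert_subset_iff, hi, hj, hk])
  rw [Finset.sum_insert (by simp; omega), Finset.sum_pair hjk.ne] at h3
  omega

theorem sub_totient_le_sub_totient_div (h : LargestPrimes m p q) {k l : ℕ} (hk : k.Prime)
    (hl : l.Prime) (hkn : k ∣ m * p * q) (hln : l ∣ m * p * q) (hkl : k ≠ l) :
    m - φ m ≤ m * p * q / k / l - φ (m * p * q / k / l) := by
  wlog hlt : k < l generalizing k l
  · rw [Nat.div_div_eq_div_mul, mul_comm k l, ← Nat.div_div_eq_div_mul]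
    exact this hl hk hln hkn hkl.symm (by omega)
  have hlq := h.le_right hl hln
  have hkq : k ≠ q := (hlt.trans_le hlq).ne
  have hdvd : ∀ {x y : ℕ}, x.Prime → y.Prime → x ∣ m * p * q → y ∣ m * p * q → x ≠ y →
      y ∣ m * p * q / x := fun hx hy hxn hyn hxy =>
    Nat.dvd_div_of_prime_of_not_dvd hx hxn hyn
      fun hd => hxy ((Nat.prime_dvd_prime_iff_eq hx hy).1 hd)
  have hsq : ∀ {x : ℕ}, x ∣ m * p * q → Squarefree (m * p * q / x) := fun hx =>
    h.squarefree.squarefree_of_dvd (Nat.div_dvd_of_dvd hx)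
  have h1 := (hsq hkn).sub_totient_div_le hl h.prime_right (hdvd hk hl hkn hln hkl)
    (hdvd hk h.prime_right hkn right_dvd hkq) hlq
  have h2 := (hsq right_dvd).sub_totient_div_le hk h.prime_left
    (hdvd h.prime_right hk right_dvd hkn hkq.symm)
    (hdvd h.prime_right h.prime_left right_dvd left_dvd h.lt.ne') (h.le_left hk hkn hkq)
  rw [h.div_right, Nat.mul_div_cancel _ h.prime_left.pos] at h2
  rw [Nat.div_div_eq_div_mul, mul_comm k q, ← Nat.div_div_eq_div_mul, h.div_right] at h1
  exact h2.trans h1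

/-- The case where `A` contains no maximal proper divisor. -/
theorem le_sum_of_cofactorPrimes_eq_empty (h : LargestPrimes m p q) {A B : Finset ℕ}
    (hA : A ⊆ (m * p * q).divisors) (hB : B ⊆ (m * p * q).divisors) (hA0 : A.Nonempty)
    (hB0 : B.Nonempty) (hAB : DvdIncomparable A B)
    (hempty : cofactorPrimes (m * p * q) A = ∅) :
    φ (m * p * q) + (φ (m * p) + φ (m * q) + (m - φ m)) ≤
      ∑ d ∈ (m * p * q).divisors \ (A ∪ B), φ d := by
  have hn := h.squarefree
  generalize hnn : m * p * q = n at *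
  have hKn : ∀ k ∈ cofactorPrimes n (n.divisors \ (A ∪ B)), k.Prime ∧ k ∣ n :=
    fun k hk => ((mem_cofactorPrimes hn.ne_zero).1 hk).1
  rcases lt_or_ge 2 (cofactorPrimes n (n.divisors \ (A ∪ B))).card with hcard | hcard
  · have h1 := totient_add_sum_add_mul_le hn hA hB hA0 hB0 hAB rfl rfl rfl
    have h2 := h.le_sum_of_two_lt_card hcard (hnn ▸ hKn)
    rw [hnn] at h2
    omega
  -- d is least in the usual order of ℕ, so none of its proper divisors lies in A; incomparability
  -- keeps them out of B.
  obtain ⟨d, hd, hdmin⟩ := A.exists_min_image id hA0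
  have hdn := Nat.dvd_of_mem_divisors (hA hd)
  have hd0 := Nat.pos_of_dvd_of_pos hdn (Nat.pos_of_ne_zero hn.ne_zero)
  -- Every prime missing from d lies in K. As d is neither n nor any n/k, at least two are missing;
  -- since |K| ≤ 2, these two exhaust K and d = n/(kl).
  have hmem : ∀ k, k.Prime → k ∣ n → ¬ k ∣ d → k ∈ cofactorPrimes n (n.divisors \ (A ∪ B)) := by
    intro k hk hkn hkd
    have hkA : n / k ∉ A := fun hA' => by
      simpa [hempty] using (mem_cofactorPrimes (A := A) hn.ne_zero).2 ⟨⟨hk, hkn⟩, hA'⟩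
    have hkB : n / k ∉ B := fun hB' =>
      (hAB d hd _ hB').1 (Nat.dvd_div_of_prime_of_not_dvd hk hkn hdn hkd)
    rw [mem_cofactorPrimes hn.ne_zero, Finset.mem_sdiff, Finset.mem_union, Nat.mem_divisors]
    exact ⟨⟨hk, hkn⟩, ⟨Nat.div_dvd_of_dvd hkn, hn.ne_zero⟩, by tauto⟩
  obtain ⟨k, hk, hkn, hkd⟩ := hn.exists_prime_of_not_dvd (d := d) fun hnd =>
    hAB.self_notMem_left hB hB0 (Nat.dvd_antisymm hdn hnd ▸ hd)
  have hdk := Nat.dvd_div_of_prime_of_not_dvd hk hkn hdn hkd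
  have hsqk := hn.squarefree_of_dvd (Nat.div_dvd_of_dvd hkn)
  obtain ⟨l, hl, hlk, hld⟩ := hsqk.exists_prime_of_not_dvd (d := d) fun hnd => by
    simpa [hempty] using (mem_cofactorPrimes (A := A) hn.ne_zero).2
      ⟨⟨hk, hkn⟩, Nat.dvd_antisymm hdk hnd ▸ hd⟩
  have hln := hlk.trans (Nat.div_dvd_of_dvd hkn)
  have hkl : k ≠ l := by
    rintro rfl
    exact hn.not_dvd_div hk hkn hlk
  have hpair : ({k, l} : Finset ℕ) ⊆ cofactorPrimes n (n.divisors \ (A ∪ B)) := by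
    simp [Finset.insert_subset_iff, hmem k hk hkn hkd, hmem l hl hln hld]
  have hK := Finset.eq_of_subset_of_card_le hpair (by rwa [Finset.card_pair hkl])
  have hdeq : d = n / k / l := by
    refine Nat.dvd_antisymm (Nat.dvd_div_of_prime_of_not_dvd hl hlk hdk hld) ?_
    by_contra hnd
    have hkl' : n / k / l ∣ n / k := Nat.div_dvd_of_dvd hlk
    obtain ⟨i, hi, hin, hid⟩ := (hsqk.squarefree_of_dvd hkl').exists_prime_of_not_dvd hnd
    have hiK := hmem i hi ((hin.trans hkl').trans (Nat.div_dvd_of_dvd hkn)) hid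
    rw [← hK, Finset.mem_insert, Finset.mem_singleton] at hiK
    rcases hiK with rfl | rfl
    · exact hn.not_dvd_div hk hkn (hin.trans hkl')
    · exact hsqk.not_dvd_div hl hlk hin
  have h1 := totient_add_sum_le hn hA hB ⟨d, hd⟩ hB0 hAB (E := d.properDivisors) ?_ ?_ ?_
  · have h2 := h.totient_add_totient_le hk hl (hnn ▸ hkn) (hnn ▸ hln) hkl
    have h3 := h.sub_totient_le_sub_totient_div hk hl (hnn ▸ hkn) (hnn ▸ hln) hkl
    rw [hnn] at h2 h3
    rw [← hdeq] at h3
    rw [← hK, Finset.sum_pair hkl, sum_totient_properDivisors hd0] at h1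
    omega
  · intro x hx
    rw [Nat.mem_properDivisors] at hx
    rw [Finset.mem_sdiff, Finset.mem_union, Nat.mem_divisors]
    refine ⟨⟨hx.1.trans hdn, hn.ne_zero⟩, ?_⟩
    rintro (hxA | hxB)
    · exact hx.2.not_ge (hdmin x hxA)
    · exact (hAB d hd x hxB).2 hx.1
  · rw [Nat.mem_properDivisors]
    exact fun hx => hx.2.not_ge (Nat.le_of_dvd (Nat.pos_of_ne_zero hn.ne_zero) hdn)
  -- No n/i divides d: it would be divisible by k, or by l when i = k, and neither divides d.
  · intro i hi hin hid
    rw [Nat.mem_properDivisors] at hid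
    by_cases hki : k ∣ i
    · rw [← (Nat.prime_dvd_prime_iff_eq hk hi).1 hki] at hid
      exact absurd (hlk.trans hid.1) hld
    · refine absurd ((Nat.dvd_div_of_prime_of_not_dvd hi hin hkn fun hik => ?_).trans hid.1) hkd
      exact hki ((Nat.prime_dvd_prime_iff_eq hi hk).1 hik ▸ dvd_rfl)

/-- For primes i of a and j of b, the nonunit fractions are at least 1/i and 1/j, and ij ≤ pq
because i ≠ j. -/
theorem le_sub_totient_mul_sub_totient_mul (h : LargestPrimes m p q) {a b c : ℕ}
    (habc : a * b * c = m * p * q) (ha : a ≠ 1) (hb : b ≠ 1) :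
    m ≤ (a - φ a) * (b - φ b) * c := by
  have hsq := h.squarefree
  rw [← habc] at hsq
  obtain ⟨i, hi, hia⟩ := Nat.exists_prime_and_dvd ha
  obtain ⟨j, hj, hjb⟩ := Nat.exists_prime_and_dvd hb
  have h1 := hsq.of_mul_left.of_mul_left.le_sub_totient_mul hi hia
  have h2 := hsq.of_mul_left.of_mul_right.le_sub_totient_mul hj hjb
  have hin : i ∣ m * p * q := habc ▸ (hia.mul_right b).mul_right c
  have hjn : j ∣ m * p * q := habc ▸ (hjb.mul_left a).mul_right c
  have hij : i ≠ j := by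
    rintro rfl
    exact hi.one_lt.ne' (Nat.eq_one_of_dvd_coprimes
      (Nat.coprime_of_squarefree_mul hsq.of_mul_left) hia hjb)
  have h3 : i * j ≤ p * q := by
    rcases hij.lt_or_gt with hlt | hlt
    · have := h.le_right hj hjn
      exact Nat.mul_le_mul (h.le_left hi hin (by omega)) this
    · have := h.le_right hi hin
      rw [mul_comm]
      exact Nat.mul_le_mul (h.le_left hj hjn (by omega)) this
  refine Nat.le_of_mul_le_mul_right ?_ (Nat.mul_pos h.prime_left.pos h.prime_right.pos)
  calc m * (p * q) = a * b * c := by rw [habc, mul_assoc]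
    _ ≤ ((a - φ a) * i) * ((b - φ b) * j) * c := Nat.mul_le_mul_right c (Nat.mul_le_mul h1 h2)
    _ = (a - φ a) * (b - φ b) * c * (i * j) := by ring
    _ ≤ _ := Nat.mul_le_mul_left _ h3

/-- A lower bound for the totient weight of the divisors separating `A` from `B` in the
divisibility order. -/
theorem min_le_sum_totient (h : LargestPrimes m p q) (hq4 : 4 ≤ q) {A B : Finset ℕ}
    (hA : A ⊆ (m * p * q).divisors) (hB : B ⊆ (m * p * q).divisors) (hA0 : A.Nonempty)
    (hB0 : B.Nonempty) (hAB : DvdIncomparable A B) :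
    min (φ (m * p * q) + (m * p - φ (m * p)))
        (φ (m * p * q) + (φ (m * p) + φ (m * q) + (m - φ m))) ≤
      ∑ d ∈ (m * p * q).divisors \ (A ∪ B), φ d := by
  rcases (cofactorPrimes (m * p * q) A).eq_empty_or_nonempty with hI | hI
  · exact (min_le_right _ _).trans
      (h.le_sum_of_cofactorPrimes_eq_empty hA hB hA0 hB0 hAB hI)
  rcases (cofactorPrimes (m * p * q) B).eq_empty_or_nonempty with hJ | hJ
  · rw [Finset.union_comm]
    exact (min_le_right _ _).trans
      (h.le_sum_of_cofactorPrimes_eq_empty hB hA hB0 hA0 hAB.symm hJ)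
  have hn := h.squarefree
  have key := totient_add_sum_add_mul_le hn hA hB hA0 hB0 hAB rfl rfl rfl
  have hprod := prod_cofactorPrimes_mul hn hAB
  have hKn : ∀ k ∈ cofactorPrimes (m * p * q) ((m * p * q).divisors \ (A ∪ B)),
      k.Prime ∧ k ∣ m * p * q := fun k hk => ((mem_cofactorPrimes hn.ne_zero).1 hk).1
  have hne : ∀ {C : Finset ℕ}, (cofactorPrimes (m * p * q) C).Nonempty →
      ∏ i ∈ cofactorPrimes (m * p * q) C, i ≠ 1 := by
    rintro C ⟨i, hi⟩ h1
    exact ((mem_cofactorPrimes hn.ne_zero).1 hi).1.1.one_lt.ne'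
      (Nat.dvd_one.1 (h1 ▸ Finset.dvd_prod_of_mem _ hi))
  have ha := hne hI
  have hb := hne hJ
  generalize ∏ i ∈ cofactorPrimes (m * p * q) A, i = a at *
  generalize ∏ i ∈ cofactorPrimes (m * p * q) B, i = b at *
  generalize cofactorPrimes (m * p * q) ((m * p * q).divisors \ (A ∪ B)) = K at *
  rcases lt_or_ge 2 K.card with hcard | hcard
  · have := h.le_sum_of_two_lt_card hcard hKn
    exact (min_le_right _ _).trans (by omega)
  interval_cases hc : K.card
  · obtain rfl := Finset.card_eq_zero.1 hc
    rw [Finset.sum_empty, Finset.prod_empty, mul_one] at key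
    rw [Finset.prod_empty, mul_one] at hprod
    have := sub_totient_le_mul (hprod ▸ hn) h.prime_right hprod.symm
      (fun k hk hkn => h.le_right hk (hprod ▸ hkn)) ha hb
    exact (min_le_left _ _).trans (by omega)
  · obtain ⟨k, rfl⟩ := Finset.card_eq_one.1 hc
    rw [Finset.sum_singleton, Finset.prod_singleton] at key
    rw [Finset.prod_singleton] at hprod
    have hk := hKn k (Finset.mem_singleton_self k)
    have := sub_totient_le_add_mul (hprod ▸ hn) hk.1 h.prime_right hq4 hprod.symm
      (fun l hl hln => h.le_right hl (hprod ▸ hln)) ha hb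
    have e : m * p * q / k = a * b := by rw [← hprod, Nat.mul_div_cancel _ hk.1.pos]
    rw [e] at key
    exact (min_le_left _ _).trans (by omega)
  · obtain ⟨k, l, hkl, rfl⟩ := Finset.card_eq_two.1 hc
    rw [Finset.sum_pair hkl] at key
    have hk := hKn k (by simp)
    have hl := hKn l (by simp)
    have h1 := h.totient_add_totient_le hk.1 hl.1 hk.2 hl.2 hkl
    have h2 := h.le_sub_totient_mul_sub_totient_mul hprod ha hb
    exact (min_le_right _ _).trans (by omega)

end LargestPrimes

/-! ### From the power graph of a cyclic group to divisors of its order -/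

/-- With t the order of y, the equation g^t = 1 has at most t solutions in a cyclic group, and the
powers of y already supply t of them. -/
theorem mem_zpowers_of_orderOf_dvd {G : Type*} [Group G] [Finite G] [IsCyclic G] {x y : G}
    (h : orderOf x ∣ orderOf y) : x ∈ Subgroup.zpowers y := by
  classical
  have := Fintype.ofFinite G
  have hsub : (Subgroup.zpowers y : Set G).toFinset ⊆
      Finset.univ.filter fun a : G => a ^ orderOf y = 1 := by
    intro a ha
    rw [Set.mem_toFinset, SetLike.mem_coe] at ha
    rw [Finset.mem_filter]
    exact ⟨Finset.mem_univ _, orderOf_dvd_iff_pow_eq_one.1 (orderOf_dvd_of_mem_zpowers ha)⟩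
  have heq := Finset.eq_of_subset_of_card_le hsub <| by
    refine (IsCyclic.card_pow_eq_one_le (orderOf_pos y)).trans ?_
    rw [Set.toFinset_card]
    exact (Fintype.card_zpowers (x := y)).ge
  have hx : x ∈ Finset.univ.filter fun a : G => a ^ orderOf y = 1 := by
    rw [Finset.mem_filter]
    exact ⟨Finset.mem_univ _, orderOf_dvd_iff_pow_eq_one.1 h⟩
  rw [← heq, Set.mem_toFinset] at hx
  exact hx

theorem exists_eq_zpow_iff_orderOf_dvd {G : Type*} [Group G] [Finite G] [IsCyclic G] {x y : G} :
    (∃ k : ℤ, x = y ^ k) ↔ orderOf x ∣ orderOf y := by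
  refine ⟨?_, fun h => ?_⟩
  · rintro ⟨k, rfl⟩
    exact orderOf_dvd_of_mem_zpowers (Subgroup.zpow_mem_zpowers y k)
  · obtain ⟨k, hk⟩ := Subgroup.mem_zpowers_iff.1 (mem_zpowers_of_orderOf_dvd h)
    exact ⟨k, hk.symm⟩

theorem powerGraph_adj_iff {G : Type*} [Group G] [Finite G] [IsCyclic G] {x y : G} :
    (powerGraph G).Adj x y ↔ x ≠ y ∧ (orderOf x ∣ orderOf y ∨ orderOf y ∣ orderOf x) := by
  simp only [powerGraph, exists_eq_zpow_iff_orderOf_dvd]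

open Nat in
theorem ncard_orderOf_mem {G : Type*} [Group G] [Finite G] [IsCyclic G] {D : Finset ℕ}
    (hD : D ⊆ (Nat.card G).divisors) : {g : G | orderOf g ∈ D}.ncard = ∑ d ∈ D, φ d := by
  classical
  have := Fintype.ofFinite G
  rw [Nat.card_eq_fintype_card] at hD
  have e : {g : G | orderOf g ∈ D} = (Finset.univ.filter fun g : G => orderOf g ∈ D : Finset G) := by
    ext g
    simp
  rw [e, Set.ncard_coe_finset, Finset.card_eq_sum_card_fiberwise (f := orderOf) (t := D)
    (fun g hg => by simpa using hg)]
  refine Finset.sum_congr rfl fun d hd => ?_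
  rw [← IsCyclic.card_orderOf_eq_totient (Nat.dvd_of_mem_divisors (hD hd)), Finset.filter_filter]
  congr 1
  ext g
  simp only [Finset.mem_filter, Finset.mem_univ, true_and]
  exact ⟨fun h => h.2, fun h => ⟨h ▸ hd, h⟩⟩

theorem exists_orderOf_eq_of_dvd {G : Type*} [Group G] [Finite G] [IsCyclic G] {d : ℕ}
    (hd : d ∈ (Nat.card G).divisors) : ∃ g : G, orderOf g = d := by
  have h := ncard_orderOf_mem (G := G) (Finset.singleton_subset_iff.2 hd)
  rw [Finset.sum_singleton] at h
  have hpos : 0 < {g : G | orderOf g ∈ ({d} : Finset ℕ)}.ncard := by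
    rw [h, Nat.totient_pos]
    exact Nat.pos_of_mem_divisors hd
  obtain ⟨g, hg⟩ := Set.nonempty_of_ncard_ne_zero hpos.ne'
  exact ⟨g, by simpa using hg⟩

/-- Removing the elements whose order is comparable to, but different from, `d` isolates the
elements of order `d` from the others. -/
theorem not_preconnected_induce_powerGraph {G : Type*} [Group G] [Finite G] [IsCyclic G]
    {D : Finset ℕ} {d e : ℕ} (hd : d ∈ (Nat.card G).divisors \ D)
    (he : e ∈ (Nat.card G).divisors \ D) (hde : d ≠ e)
    (hD : ∀ f ∈ (Nat.card G).divisors, f ∣ d ∨ d ∣ f → f = d ∨ f ∈ D) :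
    ¬ ((powerGraph G).induce {g : G | orderOf g ∈ D}ᶜ).Preconnected := by
  rw [Finset.mem_sdiff] at hd he
  obtain ⟨x, rfl⟩ := exists_orderOf_eq_of_dvd hd.1
  obtain ⟨y, rfl⟩ := exists_orderOf_eq_of_dvd he.1
  intro hpre
  obtain ⟨w⟩ := hpre ⟨x, hd.2⟩ ⟨y, he.2⟩
  -- The order is constant along a walk from x, since every other order comparable with it has been
  -- removed.
  have key : ∀ {u v : ({g : G | orderOf g ∈ D}ᶜ : Set G)},
      ((powerGraph G).induce {g : G | orderOf g ∈ D}ᶜ).Walk u v →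
      orderOf (u : G) = orderOf x → orderOf (v : G) = orderOf x := by
    intro u v w
    induction w with
    | nil => exact id
    | @cons _ v _ hadj _ ih =>
      intro hu
      refine ih ?_
      have h := (powerGraph_adj_iff.1 (SimpleGraph.induce_adj.1 hadj)).2
      rw [hu] at h
      exact (hD _ (Nat.mem_divisors.2 ⟨orderOf_dvd_natCard _, Nat.card_pos.ne'⟩)
        h.symm).resolve_right v.property
  exact hde (key w rfl).symm

open Nat in
theorem vertexConnectivity_powerGraph_le {G : Type*} [Group G] [Finite G] [IsCyclic G]
    {D : Finset ℕ} {d e : ℕ} (hDn : D ⊆ (Nat.card G).divisors)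
    (hd : d ∈ (Nat.card G).divisors \ D)
    (he : e ∈ (Nat.card G).divisors \ D) (hde : d ≠ e)
    (hD : ∀ f ∈ (Nat.card G).divisors, f ∣ d ∨ d ∣ f → f = d ∨ f ∈ D) :
    vertexConnectivity (powerGraph G) ≤ ∑ d ∈ D, φ d :=
  Nat.sInf_le ⟨_, ncard_orderOf_mem hDn,
    Or.inl (not_preconnected_induce_powerGraph hd he hde hD)⟩

theorem sum_totient_lt_of_mem_sdiff {n d : ℕ} {D : Finset ℕ} (hD : D ⊆ n.divisors)
    (hd : d ∈ n.divisors \ D) : ∑ d ∈ D, Nat.totient d < n := by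
  rw [Finset.mem_sdiff] at hd
  calc ∑ d ∈ D, Nat.totient d < ∑ d ∈ n.divisors, Nat.totient d :=
        Finset.sum_lt_sum_of_subset hD hd.1 hd.2 (Nat.totient_pos.2 (Nat.pos_of_mem_divisors hd.1))
          fun _ _ _ => Nat.zero_le _
    _ = n := Nat.sum_totient n

/-- A vertex cut of the power graph of a cyclic group separates two sets of divisors of the group
order. -/
theorem exists_dvdIncomparable_of_not_preconnected {G : Type*} [Group G] [Finite G] [IsCyclic G]
    {X : Set G} (hX : ¬ ((powerGraph G).induce Xᶜ).Preconnected) :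
    ∃ A B : Finset ℕ, A ⊆ (Nat.card G).divisors ∧ B ⊆ (Nat.card G).divisors ∧ A.Nonempty ∧
      B.Nonempty ∧ DvdIncomparable A B ∧
      ∑ d ∈ (Nat.card G).divisors \ (A ∪ B), Nat.totient d ≤ X.ncard := by
  classical
  have := Fintype.ofFinite G
  simp only [SimpleGraph.Preconnected, not_forall] at hX
  obtain ⟨u, v, huv⟩ := hX
  have hdiv : ∀ g : G, orderOf g ∈ (Nat.card G).divisors := fun g =>
    Nat.mem_divisors.2 ⟨orderOf_dvd_natCard _, Nat.card_pos.ne'⟩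
  -- A collects the orders met in the component of u, B those met elsewhere outside X. An order in
  -- neither set has all its elements in X.
  let P : (Xᶜ : Set G) → Prop := fun x => ((powerGraph G).induce Xᶜ).Reachable u x
  refine ⟨(Nat.card G).divisors.filter fun d => ∃ x, P x ∧ orderOf (x : G) = d,
    (Nat.card G).divisors.filter fun d => ∃ x, ¬ P x ∧ orderOf (x : G) = d,
    Finset.filter_subset _ _, Finset.filter_subset _ _,
    ⟨orderOf (u : G), Finset.mem_filter.2 ⟨hdiv _, u, SimpleGraph.Reachable.refl _, rfl⟩⟩,
    ⟨orderOf (v : G), Finset.mem_filter.2 ⟨hdiv _, v, huv, rfl⟩⟩, ?_, ?_⟩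
  · intro a ha b hb
    obtain ⟨-, x, hx, rfl⟩ := Finset.mem_filter.1 ha
    obtain ⟨-, y, hy, rfl⟩ := Finset.mem_filter.1 hb
    rw [← not_or]
    intro hxy
    refine hy (hx.trans (SimpleGraph.Adj.reachable ?_))
    rw [SimpleGraph.induce_adj, powerGraph_adj_iff]
    refine ⟨fun h => hy ?_, hxy⟩
    rwa [← Subtype.ext h]
  · rw [← ncard_orderOf_mem (G := G) Finset.sdiff_subset]
    refine Set.ncard_le_ncard fun g hg => ?_
    rw [Set.mem_ofPred_eq, Finset.mem_sdiff, Finset.mem_union, Finset.mem_filter,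
      Finset.mem_filter] at hg
    by_contra hgX
    refine hg.2 ?_
    by_cases hP : P ⟨g, hgX⟩
    · exact Or.inl ⟨hdiv g, _, hP, rfl⟩
    · exact Or.inr ⟨hdiv g, _, hP, rfl⟩

/-- The bound `hc` covers the removal of all vertices but one, which need not disconnect anything.
-/
theorem le_vertexConnectivity_powerGraph {G : Type*} [Group G] [Finite G] [IsCyclic G] {c : ℕ}
    (hc : c < Nat.card G)
    (h : ∀ A B : Finset ℕ, A ⊆ (Nat.card G).divisors → B ⊆ (Nat.card G).divisors → A.Nonempty →
      B.Nonempty → DvdIncomparable A B →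
      c ≤ ∑ d ∈ (Nat.card G).divisors \ (A ∪ B), Nat.totient d) :
    c ≤ vertexConnectivity (powerGraph G) := by
  refine le_csInf ?_ ?_
  · refine ⟨_, {1}ᶜ, rfl, Or.inr ?_⟩
    rw [compl_compl, Set.ncard_singleton]
  · rintro k ⟨X, rfl, hX | hX⟩
    · obtain ⟨A, B, hA, hB, hA0, hB0, hAB, hle⟩ := exists_dvdIncomparable_of_not_preconnected hX
      exact (h A B hA hB hA0 hB0 hAB).trans hle
    · have := Set.ncard_add_ncard_compl X
      omega

/-! ### The two candidate cuts and the value of the connectivity -/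

namespace LargestPrimes

open Nat

variable {m p q : ℕ}

theorem coprime_right (h : LargestPrimes m p q) : (m * p).Coprime q :=
  Nat.coprime_of_squarefree_mul h.squarefree

/-- Isolating the elements of order `m * p`. -/
theorem alpha_spec (h : LargestPrimes m p q) :
    ∃ D ⊆ (m * p * q).divisors, ∃ d ∈ (m * p * q).divisors \ D, ∃ e ∈ (m * p * q).divisors \ D,
      d ≠ e ∧ (∀ f ∈ (m * p * q).divisors, f ∣ d ∨ d ∣ f → f = d ∨ f ∈ D) ∧
      ∑ d ∈ D, φ d = φ (m * p * q) + (m * p - φ (m * p)) := by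
  have hn := h.squarefree.ne_zero
  have hm := h.pos
  have hp := h.prime_left.pos
  have hq := h.prime_right.one_lt
  have hmp : 0 < m * p := Nat.mul_pos hm hp
  have hlt : m * p < m * p * q := lt_mul_of_one_lt_right hmp hq
  have hnot : m * p * q ∉ (m * p).properDivisors := fun hd =>
    (Nat.mem_properDivisors.1 hd).2.not_ge hlt.le
  have hqmp : ¬ q ∣ m * p := fun hd =>
    hq.ne' (Nat.eq_one_of_dvd_coprimes h.coprime_right hd dvd_rfl)
  refine ⟨insert (m * p * q) (m * p).properDivisors, ?_, m * p, ?_, q, ?_, ?_, ?_, ?_⟩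
  · refine Finset.insert_subset (Nat.mem_divisors_self _ hn) fun d hd => ?_
    exact Nat.mem_divisors.2 ⟨(Nat.mem_properDivisors.1 hd).1.mul_right q, hn⟩
  · rw [Finset.mem_sdiff, Nat.mem_divisors, Finset.mem_insert, Nat.mem_properDivisors]
    exact ⟨⟨dvd_mul_right _ _, hn⟩, by omega⟩
  · rw [Finset.mem_sdiff, Nat.mem_divisors, Finset.mem_insert, Nat.mem_properDivisors]
    refine ⟨⟨dvd_mul_left _ _, hn⟩, ?_⟩
    rintro (hd | hd)
    · have h1 : m * p * q = 1 * q := by rw [one_mul, ← hd]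
      have h2 := Nat.eq_of_mul_eq_mul_right h.prime_right.pos h1
      exact h.prime_left.one_lt.ne' (Nat.eq_one_of_mul_eq_one_left h2)
    · exact hqmp hd.1
  · exact fun he => hqmp he.symm.dvd
  · intro f hf hfd
    rw [Finset.mem_insert, Nat.mem_properDivisors]
    rcases hfd with hfd | ⟨t, rfl⟩
    · rcases (Nat.le_of_dvd hmp hfd).eq_or_lt with he | hlt
      · exact Or.inl he
      · exact Or.inr (Or.inr ⟨hfd, hlt⟩)
    · have ht := Nat.dvd_of_mul_dvd_mul_left hmp (Nat.dvd_of_mem_divisors hf)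
      rcases (Nat.dvd_prime h.prime_right).1 ht with rfl | rfl <;> simp
  · rw [Finset.sum_insert hnot, sum_totient_properDivisors hmp]

/-- Isolating the elements of order `m`. -/
theorem gamma_spec (h : LargestPrimes m p q) (hm1 : m ≠ 1) :
    ∃ D ⊆ (m * p * q).divisors, ∃ d ∈ (m * p * q).divisors \ D, ∃ e ∈ (m * p * q).divisors \ D,
      d ≠ e ∧ (∀ f ∈ (m * p * q).divisors, f ∣ d ∨ d ∣ f → f = d ∨ f ∈ D) ∧
      ∑ d ∈ D, φ d = φ (m * p * q) + (φ (m * p) + φ (m * q) + (m - φ m)) := by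
  have hn := h.squarefree.ne_zero
  have hm := h.pos
  have hp := h.prime_left.one_lt
  have hq := h.prime_right.one_lt
  have hpq := h.lt
  have h1 : m < m * p := lt_mul_of_one_lt_right hm hp
  have h2 : m * p < m * q := Nat.mul_lt_mul_of_pos_left hpq hm
  have h3 : m * q < m * p * q := Nat.mul_lt_mul_of_pos_right h1 h.prime_right.pos
  have hmq : m.Coprime q := h.coprime_right.coprime_dvd_left (dvd_mul_right _ _)
  have hqm : ¬ q ∣ m := fun hd => hq.ne' (Nat.eq_one_of_dvd_coprimes hmq hd dvd_rfl)
  have hmq' : ¬ m ∣ q := fun hd => hm1 (Nat.eq_one_of_dvd_coprimes hmq dvd_rfl hd)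
  -- The three listed elements are the proper multiples of m dividing n. The order q survives as a
  -- second class because m ≠ 1; for m = 1 it would equal mq.
  refine ⟨{m * p * q, m * p, m * q} ∪ m.properDivisors, ?_, m, ?_, q, ?_, ?_, ?_, ?_⟩
  · intro d hd
    rw [Finset.mem_union, Nat.mem_properDivisors] at hd
    rw [Nat.mem_divisors]
    refine ⟨?_, hn⟩
    rcases hd with hd | hd
    · simp only [Finset.mem_insert, Finset.mem_singleton] at hd
      rcases hd with rfl | rfl | rfl
      · exact dvd_rfl
      · exact dvd_mul_right _ _
      · rw [mul_right_comm]
        exact dvd_mul_right _ _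
    · exact (hd.1.mul_right p).mul_right q
  · rw [Finset.mem_sdiff, Nat.mem_divisors]
    refine ⟨⟨(dvd_mul_right _ _).mul_right _, hn⟩, ?_⟩
    simp only [Finset.mem_union, Finset.mem_insert, Finset.mem_singleton, Nat.mem_properDivisors]
    omega
  · rw [Finset.mem_sdiff, Nat.mem_divisors]
    refine ⟨⟨dvd_mul_left _ _, hn⟩, ?_⟩
    simp only [Finset.mem_union, Finset.mem_insert, Finset.mem_singleton, Nat.mem_properDivisors]
    rintro ((hd | hd | hd) | hd)
    · exact hmq' (hd ▸ (dvd_mul_right _ _).mul_right _)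
    · exact hmq' (hd ▸ dvd_mul_right _ _)
    · exact hmq' (hd ▸ dvd_mul_right _ _)
    · exact hqm hd.1
  · exact fun he => hqm he.symm.dvd
  · intro f hf hfd
    simp only [Finset.mem_union, Finset.mem_insert, Finset.mem_singleton, Nat.mem_properDivisors]
    rcases hfd with hfd | ⟨t, rfl⟩
    · rcases (Nat.le_of_dvd hm hfd).eq_or_lt with he | hlt
      · exact Or.inl he
      · exact Or.inr (Or.inr ⟨hfd, hlt⟩)
    · have ht := Nat.dvd_of_mem_divisors hf
      rw [mul_assoc] at ht
      obtain ⟨x, y, hx, hy, rfl⟩ := Nat.dvd_mul.1 (Nat.dvd_of_mul_dvd_mul_left hm ht)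
      rcases (Nat.dvd_prime h.prime_left).1 hx with rfl | rfl <;>
        rcases (Nat.dvd_prime h.prime_right).1 hy with rfl | rfl <;> simp [mul_assoc]
  · rw [Finset.sum_union, sum_totient_properDivisors hm, Finset.sum_insert, Finset.sum_pair h2.ne]
    · ring
    · simp only [Finset.mem_insert, Finset.mem_singleton]
      omega
    · rw [Finset.disjoint_left]
      intro d hd
      simp only [Finset.mem_insert, Finset.mem_singleton] at hd
      rw [Nat.mem_properDivisors]
      omega

theorem vertexConnectivity_powerGraph (h : LargestPrimes m p q) (hm1 : m ≠ 1) (hq4 : 4 ≤ q)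
    {G : Type*} [Group G] [Finite G] [IsCyclic G] (hG : Nat.card G = m * p * q) :
    vertexConnectivity (powerGraph G) = min (φ (m * p * q) + (m * p - φ (m * p)))
      (φ (m * p * q) + (φ (m * p) + φ (m * q) + (m - φ m))) := by
  obtain ⟨D, hD, d, hd, e, he, hde, hDd, hsum⟩ := h.alpha_spec
  obtain ⟨D', hD', d', hd', e', he', hde', hDd', hsum'⟩ := h.gamma_spec hm1
  have hlt := sum_totient_lt_of_mem_sdiff hD hd
  rw [hsum] at hlt
  rw [← hG] at hD hd he hDd hD' hd' he' hDd'
  refine le_antisymm (le_min ?_ ?_) (le_vertexConnectivity_powerGraph ?_ ?_)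
  · rw [← hsum]
    exact vertexConnectivity_powerGraph_le hD hd he hde hDd
  · rw [← hsum']
    exact vertexConnectivity_powerGraph_le hD' hd' he' hde' hDd'
  · rw [hG]
    exact (min_le_left _ _).trans_lt hlt
  · rw [hG]
    exact fun A B hA hB hA0 hB0 hAB => h.min_le_sum_totient hq4 hA hB hA0 hB0 hAB

end LargestPrimes

/-! ### Increasing sequences of primes satisfy `LargestPrimes` -/

section IncreasingPrimes

variable {r : ℕ} {p : ℕ → ℕ}

theorem exists_eq_of_prime_dvd_prod {t k : ℕ} (hp : ∀ i ∈ Finset.Icc 1 t, Nat.Prime (p i))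
    (hk : k.Prime) (h : k ∣ ∏ i ∈ Finset.Icc 1 t, p i) : ∃ i ∈ Finset.Icc 1 t, k = p i := by
  obtain ⟨i, hi, hki⟩ := (hk.prime.dvd_finsetProd_iff _).1 h
  exact ⟨i, hi, (Nat.prime_dvd_prime_iff_eq hk (hp i hi)).1 hki⟩

theorem succ_le_of_increasing_primes (hp : ∀ i ∈ Finset.Icc 1 r, Nat.Prime (p i))
    (hlt : ∀ i ∈ Finset.Icc 1 r, ∀ j ∈ Finset.Icc 1 r, i < j → p i < p j) {i : ℕ}
    (hi : i ∈ Finset.Icc 1 r) : i + 1 ≤ p i := by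
  induction i with
  | zero => simp at hi
  | succ i ih =>
    rcases Nat.eq_zero_or_pos i with rfl | h0
    · exact (hp _ hi).two_le
    · have hi' : i ∈ Finset.Icc 1 r := by
        rw [Finset.mem_Icc] at hi ⊢
        omega
      have := ih hi'
      have := hlt i hi' _ hi (Nat.lt_succ_self i)
      omega

/-- As p_i ≥ i + 1, the product of the 1 - 1/p_i is at least the telescoping product of the i/(i +
1), which is 1/(t + 1). -/
theorem squarefree_prod_and_le_totient_mul (hp : ∀ i ∈ Finset.Icc 1 r, Nat.Prime (p i))
    (hlt : ∀ i ∈ Finset.Icc 1 r, ∀ j ∈ Finset.Icc 1 r, i < j → p i < p j) {t : ℕ} (ht : t ≤ r) :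
    Squarefree (∏ i ∈ Finset.Icc 1 t, p i) ∧
      ∏ i ∈ Finset.Icc 1 t, p i ≤ Nat.totient (∏ i ∈ Finset.Icc 1 t, p i) * (t + 1) := by
  induction t with
  | zero => simp
  | succ t ih =>
    obtain ⟨h1, h2⟩ := ih (by omega)
    have hmem : t + 1 ∈ Finset.Icc 1 r := by
      rw [Finset.mem_Icc]
      omega
    have hpt := hp _ hmem
    have hcop : (∏ i ∈ Finset.Icc 1 t, p i).Coprime (p (t + 1)) := by
      rw [Nat.coprime_comm, Nat.Prime.coprime_iff_not_dvd hpt]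
      intro hdvd
      obtain ⟨i, hi, he⟩ := exists_eq_of_prime_dvd_prod (fun i hi => hp i
        (Finset.Icc_subset_Icc_right (by omega) hi)) hpt hdvd
      have := hlt i (Finset.Icc_subset_Icc_right (by omega) hi) _ hmem
        (by rw [Finset.mem_Icc] at hi; omega)
      omega
    rw [Finset.prod_Icc_succ_top (by omega)]
    refine ⟨(Nat.squarefree_mul hcop).2 ⟨h1, hpt.prime.squarefree⟩, ?_⟩
    rw [Nat.totient_mul hcop, Nat.totient_prime hpt]
    have h3 := succ_le_of_increasing_primes hp hlt hmem
    obtain ⟨s, hs⟩ := Nat.exists_eq_add_of_le h3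
    rw [hs]
    have e : t + 1 + 1 + s - 1 = t + 1 + s := by omega
    rw [e]
    calc _ ≤ (Nat.totient (∏ i ∈ Finset.Icc 1 t, p i) * (t + 1)) * (t + 1 + 1 + s) :=
          Nat.mul_le_mul_right _ h2
      _ = Nat.totient (∏ i ∈ Finset.Icc 1 t, p i) * ((t + 1) * (t + 1 + 1 + s)) := by ring
      _ ≤ Nat.totient (∏ i ∈ Finset.Icc 1 t, p i) * ((t + 1 + s) * (t + 1 + 1)) :=
          Nat.mul_le_mul_left _ (by nlinarith)
      _ = _ := by ring

theorem largestPrimes_of_increasing_primes {s : ℕ}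
    (hp : ∀ i ∈ Finset.Icc 1 (s + 2), Nat.Prime (p i))
    (hlt : ∀ i ∈ Finset.Icc 1 (s + 2), ∀ j ∈ Finset.Icc 1 (s + 2), i < j → p i < p j) :
    LargestPrimes (∏ i ∈ Finset.Icc 1 s, p i) (p (s + 1)) (p (s + 2)) := by
  have h1 : s + 1 ∈ Finset.Icc 1 (s + 2) := by
    rw [Finset.mem_Icc]
    omega
  have h2 : s + 2 ∈ Finset.Icc 1 (s + 2) := by
    rw [Finset.mem_Icc]
    omega
  obtain ⟨hsq, hle⟩ := squarefree_prod_and_le_totient_mul hp hlt le_rfl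
  rw [Finset.prod_Icc_succ_top (by omega), Finset.prod_Icc_succ_top (by omega)] at hsq hle
  refine ⟨hsq, hp _ h1, hp _ h2, hlt _ h1 _ h2 (by omega), fun k hk hkd => ?_,
    hle.trans (Nat.mul_le_mul_left _ (succ_le_of_increasing_primes hp hlt h2))⟩
  obtain ⟨i, hi, rfl⟩ := exists_eq_of_prime_dvd_prod
    (fun i hi => hp i (Finset.Icc_subset_Icc_right (by omega) hi)) hk hkd
  exact hlt i (Finset.Icc_subset_Icc_right (by omega) hi) _ h1
    (by rw [Finset.mem_Icc] at hi; omega)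

end IncreasingPrimes

/-- The vertex connectivity of the power graph of the cyclic group of order `n = p₁p₂⋯pᵣ`, where
`r ≥ 3` and `p₁ < p₂ < ⋯ < pᵣ` are primes (only the values `p 1, …, p r` of `p` matter). -/
theorem theorem1p3 (r : ℕ) (hr : 3 ≤ r) (p : ℕ → ℕ)
    (hp : ∀ i ∈ Finset.Icc 1 r, Nat.Prime (p i))
    (hlt : ∀ i ∈ Finset.Icc 1 r, ∀ j ∈ Finset.Icc 1 r, i < j → p i < p j)
    (n : ℕ) (hn : n = ∏ i ∈ Finset.Icc 1 r, p i)
    (G : Type*) [Group G] [Finite G] [IsCyclic G] (hG : Nat.card G = n) :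
    vertexConnectivity (powerGraph G) = min (alphaBound r p n) (gammaBound r p n) := by
  obtain ⟨s, rfl⟩ : ∃ s, r = s + 2 := ⟨r - 2, by omega⟩
  have h := largestPrimes_of_increasing_primes hp hlt
  have hq : s + 2 ∈ Finset.Icc 1 (s + 2) := by
    rw [Finset.mem_Icc]
    omega
  -- The bound is s + 3 ≤ p_r; r ≥ 3 means s ≥ 1, whence p_r ≥ 4.
  have hq4 := succ_le_of_increasing_primes hp hlt hq
  have h1 : 1 ∈ Finset.Icc 1 s := by
    rw [Finset.mem_Icc]
    omega
  have hm1 : ∏ i ∈ Finset.Icc 1 s, p i ≠ 1 := by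
    intro he
    have hdvd := Finset.dvd_prod_of_mem p h1
    rw [he] at hdvd
    exact (hp 1 (Finset.Icc_subset_Icc_right (by omega) h1)).one_lt.ne' (Nat.dvd_one.1 hdvd)
  have e1 : ∏ i ∈ Finset.Icc 1 (s + 1), p i = (∏ i ∈ Finset.Icc 1 s, p i) * p (s + 1) :=
    Finset.prod_Icc_succ_top (by omega) p
  have e2 : n = (∏ i ∈ Finset.Icc 1 s, p i) * p (s + 1) * p (s + 2) := by
    rw [hn, Finset.prod_Icc_succ_top (by omega), e1]
  have hnpos : 0 < n := hG ▸ Nat.card_pos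
  rw [h.vertexConnectivity_powerGraph hm1 (by omega) (hG.trans e2), alphaBound, gammaBound, ← hn,
    Nat.div_self hnpos, one_mul, one_mul, ← e2]
  simp only [Nat.add_sub_cancel, Nat.add_succ_sub_one, e1]
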